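/- Let $\mathcal M_0=\{\Sigma : \sigma_{12}=0\}$ and $\mathcal M_1=\{\Sigma : \sigma_{12}\sigma_{33}=\sigma_{13}\sigma_{23}\}$ as subsets of the real symmetric positive definite $3\times 3$ matrices $\Sigma=(\sigma_{jk})$; for a centred Gaussian vector $(X_1,X_2,X_3)\sim\mathcal N(0,\Sigma)$ they express $X_1\perp X_2$ and $X_1\perp X_2\mid X_3$, respectively. For a sample $x_1,\dots,x_n\in\mathbb R^3$ put $S_n=\frac1n\sum_{m=1}^n x_mx_m^{\mathsf T}$, $\ell_n(\Sigma)=\frac n2\bigl(-\log\det\Sigma-\operatorname{tr}(S_n\Sigma^{-1})\bigr)$ and $$\lambda_n^{(0:1)}=2\Bigl(\sup_{\Sigma\in\mathcal M_0}\ell_n(\Sigma)-\sup_{\Sigma\in\mathcal M_1}\ell_n(\Sigma)\Bigr).$$ Let $i\in\{0,1\}$, $\delta\in\mathbb R\setminus\{0\}$, and let $\Sigma_n\in\mathcal M_i\setminus\mathcal M_{1-i}$ $(n\ge 1)$ be any sequence whose correlation coefficients $\rho_{jk,n}=\sigma_{jk,n}/\sqrt{\sigma_{jj,n}\sigma_{kk,n}}$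 satisfy, as $n\to\infty$, $\rho_{13,n}\to0$, $\rho_{23,n}\to0$ and $$\rho_{13,n}\,\rho_{23,n}=\delta n^{-1/2}+o(n^{-1/2}).$$ For each $n$ let $x_1,\dots,x_n$ be independent with law $\mathcal N(0,\Sigma_n)$. Then for every $n\ge3$ both suprema are almost surely finite, and $$\lambda_n^{(0:1)}\ \xrightarrow{\ d\ }\ \delta\bigl(2Z+(-1)^i\delta\bigr)\ =_d\ \mathcal N\bigl((-1)^i\delta^2,\,(2\delta)^2\bigr),\qquad Z\sim\mathcal N(0,1).$$ In particular the limit law does not depend on how $\rho_{13,n}$ and $\rho_{23,n}$ individually tend to zero. -/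

import Mathlib

open MeasureTheory ProbabilityTheory Filter Topology Asymptotics

noncomputable section

namespace TrivariateGaussian

/-- The two models inside the parameter space of positive definite `3 × 3` covariance matrices.
Coordinates `1, 2, 3` of the random vector are the indices `0, 1, 2`.
Model `0` is marginal independence of the first two coordinates (`σ₁₂ = 0`), model `1` is their
conditional independence given the third one (`σ₁₂ σ₃₃ = σ₁₃ σ₂₃`). -/
def model : Fin 2 → Set (Matrix (Fin 3) (Fin 3) ℝ)
  | 0 => {C | C.PosDef ∧ C 0 1 = 0}
  | 1 => {C | C.PosDef ∧ C 0 1 * C 2 2 = C 0 2 * C 1 2}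

/-- The correlation coefficient between coordinates `j` and `k` of a covariance matrix. -/
def corr (C : Matrix (Fin 3) (Fin 3) ℝ) (j k : Fin 3) : ℝ :=
  C j k / Real.sqrt (C j j * C k k)

/-- The law of `n` independent observations from the centred Gaussian law with covariance `C`. -/
def sampleLaw (n : ℕ) (C : Matrix (Fin 3) (Fin 3) ℝ) :
    Measure (Fin n → EuclideanSpace ℝ (Fin 3)) :=
  Measure.pi fun _ => multivariateGaussian 0 C

instance (n : ℕ) (C : Matrix (Fin 3) (Fin 3) ℝ) : IsProbabilityMeasure (sampleLaw n C) := by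
  unfold sampleLaw; infer_instance

/-- The sample covariance computed with respect to mean zero. -/
def sampleCov (n : ℕ) (x : Fin n → EuclideanSpace ℝ (Fin 3)) : Matrix (Fin 3) (Fin 3) ℝ :=
  Matrix.of fun j k => (∑ m, x m j * x m k) / n

/-- The Gaussian log-likelihood of the covariance `C` for sample size `n` and sample
covariance `S`, up to the additive constant `-(3 n / 2) log (2 π)`. -/
def logLik (n : ℕ) (S C : Matrix (Fin 3) (Fin 3) ℝ) : ℝ :=
  n / 2 * (-Real.log C.det - (S * C⁻¹).trace)

/-- The log-likelihood maximized within model `j`, for the data `x`. The supremum is a genuine one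
when the log-likelihood is bounded above on the model. -/
def maxLogLik (n : ℕ) (j : Fin 2) (x : Fin n → EuclideanSpace ℝ (Fin 3)) : ℝ :=
  sSup (logLik n (sampleCov n x) '' model j)

/-- The log-likelihood ratio statistic contrasting model `0` with model `1`. -/
def lrStat (n : ℕ) (x : Fin n → EuclideanSpace ℝ (Fin 3)) : ℝ :=
  2 * (maxLogLik n 0 x - maxLogLik n 1 x)

end TrivariateGaussian

end

/-! When the sample covariance `S` is nonsingular, both models are maximized in closed form: each is
a Gaussian regression model, so the likelihood separates into three variances. Hence the statistic
is `n log (minorRatio S)`. This ratio is unchanged by rescaling the coordinates, so only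
correlations matter. For unit diagonal, with off-diagonal entries `r, s, t` at positions 12, 13, 23,
the numerator of `minorRatio S - 1` is `r²s² + r²t² + s²t² - r²s²t² - 2rst`.

Put `U = √n r` and `T = √n s t`. If `U` stays bounded, `s, t → 0` and `T → δ`, then `n (minorRatio S
- 1)` is `T² - 2UT + o(1)`, that is `δ² - 2δU + o(1)`. Sampling noise of order `n^(-1/2)` in `s` and
`t` changes `T` only by `o(1)` because both population correlations vanish, so the individual rates
play no role. The only randomness left is `U = c + G`, with `c = lim √n ρ₁₂` and `G` asymptotically
standard normal. Model 0 gives `c = 0`; model 1 gives `ρ₁₂ = ρ₁₃ρ₂₃`, so `c = δ`. These produce the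
means `±δ²`.

To avoid a central limit theorem for triangular arrays, all samples are linear images of one i.i.d.
noise sequence (`noiseLaw_map_linearSample`). The expansion is deterministic
(`tendsto_mul_log_minorRatio_perturbation`), uniform over bounded fluctuations, and becomes
convergence in probability by tightness (`tendstoInMeasure_lrStat_sub`). -/

namespace TrivariateGaussian

/-! ### Closed-form likelihood maxima. -/

section Likelihood

open Matrix

/-- Sylvester's criterion for symmetric `3 × 3` matrices. -/
lemma posDef_of_minors {C : Matrix (Fin 3) (Fin 3) ℝ} (h01 : C 1 0 = C 0 1) (h02 : C 2 0 = C 0 2)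
    (h12 : C 2 1 = C 1 2) (h0 : 0 < C 0 0) (h1 : 0 < C 0 0 * C 1 1 - C 0 1 ^ 2) (h2 : 0 < C.det) :
    C.PosDef := by
  refine Matrix.PosDef.of_dotProduct_mulVec_pos ?_ ?_
  · ext i j
    fin_cases i <;> fin_cases j <;> simp [Matrix.conjTranspose, h01, h02, h12]
  · intro x hx
    rw [Matrix.det_fin_three, h01, h02, h12] at h2
    simp only [dotProduct, mulVec, Fin.sum_univ_three, star_trivial, h01, h02, h12]
    set a := C 0 0
    set b := C 0 1
    set c := C 0 2
    set d := C 1 1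
    set e := C 1 2
    set f := C 2 2
    -- Completing squares, cleared of denominators by the two leading minors.
    have key : a * (a * d - b ^ 2) * (x 0 * (a * x 0 + b * x 1 + c * x 2) +
        x 1 * (b * x 0 + d * x 1 + e * x 2) + x 2 * (c * x 0 + e * x 1 + f * x 2)) =
        (a * d - b ^ 2) * (a * x 0 + b * x 1 + c * x 2) ^ 2 +
        ((a * d - b ^ 2) * x 1 + (a * e - b * c) * x 2) ^ 2 +
        a * (a * d * f - a * e * e - b * b * f + b * e * c + c * b * e - c * d * c) * x 2 ^ 2 := by
      ring
    have hpos : 0 < a * (a * d - b ^ 2) := mul_pos h0 h1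
    refine pos_of_mul_pos_right (a := a * (a * d - b ^ 2)) ?_ hpos.le
    rw [key]
    have t1 : 0 ≤ (a * d - b ^ 2) * (a * x 0 + b * x 1 + c * x 2) ^ 2 := by positivity
    have t2 := sq_nonneg ((a * d - b ^ 2) * x 1 + (a * e - b * c) * x 2)
    have t3 := mul_nonneg (mul_pos h0 h2).le (sq_nonneg (x 2))
    by_cases hx2 : x 2 = 0
    · by_cases hx1 : x 1 = 0
      · have hx0 : x 0 ≠ 0 := by
          intro hx0
          apply hx
          ext i
          fin_cases i <;> simp [hx0, hx1, hx2]
        have : 0 < (a * d - b ^ 2) * (a * x 0 + b * x 1 + c * x 2) ^ 2 := by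
          rw [hx1, hx2]
          simp only [mul_zero, add_zero]
          positivity
        linarith
      · have : 0 < ((a * d - b ^ 2) * x 1 + (a * e - b * c) * x 2) ^ 2 := by
          rw [hx2]
          simp only [mul_zero, add_zero]
          positivity
        linarith
    · have : 0 < a * (a * d * f - a * e * e - b * b * f + b * e * c + c * b * e - c * d * c)
          * x 2 ^ 2 := mul_pos (mul_pos h0 h2) (by positivity)
      linarith

lemma posDef_apply_comm {C : Matrix (Fin 3) (Fin 3) ℝ} (hC : C.PosDef) (j k : Fin 3) :
    C j k = C k j := by
  simpa using hC.isHermitian.apply k j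

lemma posDef_minor_pos {C : Matrix (Fin 3) (Fin 3) ℝ} (hC : C.PosDef) {j k : Fin 3} (h : j ≠ k) :
    0 < C j j * C k k - C j k ^ 2 := by
  have hinj : Function.Injective ![j, k] := by
    intro a b hab
    fin_cases a <;> fin_cases b <;> simp_all
  have := (hC.submatrix hinj).det_pos
  rw [Matrix.det_fin_two] at this
  simpa [posDef_apply_comm hC k j, sq] using this

/-- The covariance of `(X₁, X₂, α X₁ + β X₂ + ε)` for independent `X₁, X₂, ε` of variances
`p, q, w`. -/
def collider (p q w α β : ℝ) : Matrix (Fin 3) (Fin 3) ℝ :=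
  !![p, 0, p * α; 0, q, q * β; p * α, q * β, w + p * α ^ 2 + q * β ^ 2]

/-- The covariance of `(α X₃ + ε₁, β X₃ + ε₂, X₃)` for independent `ε₁, ε₂, X₃` of variances
`p, q, w`. -/
def fork (p q w α β : ℝ) : Matrix (Fin 3) (Fin 3) ℝ :=
  !![p + α ^ 2 * w, α * β * w, α * w; α * β * w, q + β ^ 2 * w, β * w; α * w, β * w, w]

lemma det_collider (p q w α β : ℝ) : (collider p q w α β).det = p * q * w := by
  simp [collider, Matrix.det_fin_three]
  ring

lemma det_fork (p q w α β : ℝ) : (fork p q w α β).det = p * q * w := by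
  simp [fork, Matrix.det_fin_three]
  ring

lemma collider_mem_model {p q w : ℝ} (hp : 0 < p) (hq : 0 < q) (hw : 0 < w) (α β : ℝ) :
    collider p q w α β ∈ model 0 := by
  refine ⟨posDef_of_minors ?_ ?_ ?_ ?_ ?_ ?_, ?_⟩
  · simp [collider]
  · simp [collider]
  · simp [collider]
  · simpa [collider] using hp
  · simpa [collider] using mul_pos hp hq
  · rw [det_collider]
    positivity
  · simp [collider]

lemma fork_mem_model {p q w : ℝ} (hp : 0 < p) (hq : 0 < q) (hw : 0 < w) (α β : ℝ) :
    fork p q w α β ∈ model 1 := by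
  refine ⟨posDef_of_minors ?_ ?_ ?_ ?_ ?_ ?_, ?_⟩
  · simp [fork]
  · simp [fork]
  · simp [fork]
  · simp [fork]
    positivity
  · simp [fork]
    have : (p + α ^ 2 * w) * (q + β ^ 2 * w) - (α * β * w) ^ 2 =
      p * q + p * (β ^ 2 * w) + q * (α ^ 2 * w) := by ring
    have : 0 < p * q + p * (β ^ 2 * w) + q * (α ^ 2 * w) := by positivity
    linarith
  · rw [det_fork]
    positivity
  · simp [fork]
    ring

/-- Regress `X₃` on the uncorrelated `X₁, X₂`; `w` is the residual variance, positive because the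
determinant is `p q w`. -/
lemma exists_eq_collider {C : Matrix (Fin 3) (Fin 3) ℝ} (hC : C ∈ model 0) :
    ∃ p q w α β, 0 < p ∧ 0 < q ∧ 0 < w ∧ C = collider p q w α β := by
  obtain ⟨hpd, h0⟩ := hC
  have hp : 0 < C 0 0 := hpd.diag_pos
  have hq : 0 < C 1 1 := hpd.diag_pos
  have hdet := hpd.det_pos
  have e10 := posDef_apply_comm hpd 1 0
  have e20 := posDef_apply_comm hpd 2 0
  have e21 := posDef_apply_comm hpd 2 1
  have hEq : C = collider (C 0 0) (C 1 1) (C 2 2 - C 0 2 ^ 2 / C 0 0 - C 1 2 ^ 2 / C 1 1)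
      (C 0 2 / C 0 0) (C 1 2 / C 1 1) := by
    ext i j
    fin_cases i <;> fin_cases j <;> simp [collider, e10, e20, e21, h0] <;> field_simp
    ring
  refine ⟨_, _, _, _, _, hp, hq, ?_, hEq⟩
  rw [hEq, det_collider] at hdet
  exact pos_of_mul_pos_right hdet (mul_pos hp hq).le

/-- Regress `X₁` and `X₂` separately on `X₃`; the constraint on `σ₁₂` says that the residuals are
uncorrelated. -/
lemma exists_eq_fork {C : Matrix (Fin 3) (Fin 3) ℝ} (hC : C ∈ model 1) :
    ∃ p q w α β, 0 < p ∧ 0 < q ∧ 0 < w ∧ C = fork p q w α β := by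
  obtain ⟨hpd, h0⟩ := hC
  have hw : 0 < C 2 2 := hpd.diag_pos
  have h02 := posDef_minor_pos hpd (show (0 : Fin 3) ≠ 2 by decide)
  have h12 := posDef_minor_pos hpd (show (1 : Fin 3) ≠ 2 by decide)
  have e10 := posDef_apply_comm hpd 1 0
  have e20 := posDef_apply_comm hpd 2 0
  have e21 := posDef_apply_comm hpd 2 1
  have h0' : C 0 1 = C 0 2 * C 1 2 / C 2 2 := by
    rw [eq_div_iff hw.ne', h0]
  refine ⟨(C 0 0 * C 2 2 - C 0 2 ^ 2) / C 2 2, (C 1 1 * C 2 2 - C 1 2 ^ 2) / C 2 2, C 2 2,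
    C 0 2 / C 2 2, C 1 2 / C 2 2, by positivity, by positivity, hw, ?_⟩
  ext i j
  fin_cases i <;> fin_cases j <;> simp [fork, e10, e20, e21, h0'] <;> field_simp <;> ring

/-- The last numerator is the empirical residual variance of `X₃ - αX₁ - βX₂`, so each of `p, q, w`
can be optimized on its own. -/
lemma trace_mul_collider_inv {S : Matrix (Fin 3) (Fin 3) ℝ} (hS : S.PosDef) {p q w : ℝ}
    (hp : 0 < p) (hq : 0 < q) (hw : 0 < w) (α β : ℝ) :
    (S * (collider p q w α β)⁻¹).trace = S 0 0 / p + S 1 1 / q +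
      (S 2 2 - 2 * α * S 0 2 - 2 * β * S 1 2 + α ^ 2 * S 0 0 + 2 * α * β * S 0 1
        + β ^ 2 * S 1 1) / w := by
  have hinv : (collider p q w α β)⁻¹ = !![1 / p + α ^ 2 / w, α * β / w, -α / w;
      α * β / w, 1 / q + β ^ 2 / w, -β / w; -α / w, -β / w, 1 / w] := by
    refine Matrix.inv_eq_right_inv ?_
    ext i j
    fin_cases i <;> fin_cases j <;>
      simp [collider, Matrix.mul_apply, Fin.sum_univ_three] <;> field_simp <;> ring
  rw [hinv]
  simp [Matrix.trace, Matrix.mul_apply, Fin.sum_univ_three, posDef_apply_comm hS 1 0,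
    posDef_apply_comm hS 2 0, posDef_apply_comm hS 2 1]
  field_simp
  ring

lemma trace_mul_fork_inv {S : Matrix (Fin 3) (Fin 3) ℝ} (hS : S.PosDef) {p q w : ℝ}
    (hp : 0 < p) (hq : 0 < q) (hw : 0 < w) (α β : ℝ) :
    (S * (fork p q w α β)⁻¹).trace = (S 0 0 - 2 * α * S 0 2 + α ^ 2 * S 2 2) / p +
      (S 1 1 - 2 * β * S 1 2 + β ^ 2 * S 2 2) / q + S 2 2 / w := by
  have hinv : (fork p q w α β)⁻¹ = !![1 / p, 0, -α / p; 0, 1 / q, -β / q;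
      -α / p, -β / q, 1 / w + α ^ 2 / p + β ^ 2 / q] := by
    refine Matrix.inv_eq_right_inv ?_
    ext i j
    fin_cases i <;> fin_cases j <;>
      simp [fork, Matrix.mul_apply, Fin.sum_univ_three] <;> field_simp <;> ring
  rw [hinv]
  simp [Matrix.trace, Matrix.mul_apply, Fin.sum_univ_three, posDef_apply_comm hS 1 0,
    posDef_apply_comm hS 2 0, posDef_apply_comm hS 2 1]
  field_simp
  ring

/-- A single variance term of the likelihood. Allowing `s ≤ t` lets `s` be the least residual
variance over all regression coefficients. -/
lemma neg_log_sub_div_le {s t v : ℝ} (hs : 0 < s) (ht : s ≤ t) (hv : 0 < v) :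
    -Real.log v - t / v ≤ -Real.log s - 1 := by
  have h1 := Real.log_le_sub_one_of_pos (div_pos hs hv)
  rw [Real.log_div hs.ne' hv.ne'] at h1
  have h2 : s / v ≤ t / v := by gcongr
  linarith

lemma log_mul_mul {a b c : ℝ} (ha : 0 < a) (hb : 0 < b) (hc : 0 < c) :
    Real.log (a * b * c) = Real.log a + Real.log b + Real.log c := by
  rw [Real.log_mul (by positivity) hc.ne', Real.log_mul ha.ne' hb.ne']

/-- The likelihood maximum under marginal independence. -/
lemma isGreatest_logLik_model_zero (n : ℕ) {S : Matrix (Fin 3) (Fin 3) ℝ} (hS : S.PosDef) :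
    IsGreatest (logLik n S '' model 0)
      (n / 2 * (-Real.log (S 0 0 * S 1 1 * (S.det / (S 0 0 * S 1 1 - S 0 1 ^ 2))) - 3)) := by
  have h0 : 0 < S 0 0 := hS.diag_pos
  have h1 : 0 < S 1 1 := hS.diag_pos
  have hm := posDef_minor_pos hS (show (0 : Fin 3) ≠ 1 by decide)
  have hdet := hS.det_pos
  have hκ : 0 < S.det / (S 0 0 * S 1 1 - S 0 1 ^ 2) := by positivity
  have hdetS : S.det = S 0 0 * S 1 1 * S 2 2 - S 0 0 * S 1 2 ^ 2 - S 1 1 * S 0 2 ^ 2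
      - S 2 2 * S 0 1 ^ 2 + 2 * S 0 1 * S 0 2 * S 1 2 := by
    rw [Matrix.det_fin_three, posDef_apply_comm hS 1 0, posDef_apply_comm hS 2 0,
      posDef_apply_comm hS 2 1]
    ring
  constructor
  -- The coefficients solve the normal equations by Cramer's rule; the residual variance is the
  -- Schur complement of the upper `2 × 2` block.
  · refine ⟨collider (S 0 0) (S 1 1) (S.det / (S 0 0 * S 1 1 - S 0 1 ^ 2))
      ((S 0 2 * S 1 1 - S 1 2 * S 0 1) / (S 0 0 * S 1 1 - S 0 1 ^ 2))
      ((S 1 2 * S 0 0 - S 0 2 * S 0 1) / (S 0 0 * S 1 1 - S 0 1 ^ 2)),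
      collider_mem_model h0 h1 hκ _ _, ?_⟩
    rw [logLik, trace_mul_collider_inv hS h0 h1 hκ, det_collider]
    congr 1
    have hquad : ∀ α β : ℝ, α = (S 0 2 * S 1 1 - S 1 2 * S 0 1) / (S 0 0 * S 1 1 - S 0 1 ^ 2) →
        β = (S 1 2 * S 0 0 - S 0 2 * S 0 1) / (S 0 0 * S 1 1 - S 0 1 ^ 2) →
        S 2 2 - 2 * α * S 0 2 - 2 * β * S 1 2 + α ^ 2 * S 0 0 + 2 * α * β * S 0 1
        + β ^ 2 * S 1 1 = S.det / (S 0 0 * S 1 1 - S 0 1 ^ 2) := by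
      intro α β hα hβ
      rw [eq_div_iff hm.ne'] at hα hβ
      rw [hdetS, eq_div_iff hm.ne']
      refine mul_left_cancel₀ hm.ne' ?_
      have : ∀ m : ℝ, m * ((S 2 2 - 2 * α * S 0 2 - 2 * β * S 1 2 + α ^ 2 * S 0 0
          + 2 * α * β * S 0 1 + β ^ 2 * S 1 1) * m) = S 2 2 * m ^ 2 - 2 * (α * m) * m * S 0 2
          - 2 * (β * m) * m * S 1 2 + (α * m) ^ 2 * S 0 0 + 2 * (α * m) * (β * m) * S 0 1
          + (β * m) ^ 2 * S 1 1 := by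
        intros
        ring
      rw [this, hα, hβ]
      ring
    rw [hquad _ _ rfl rfl, div_self hκ.ne', div_self h0.ne', div_self h1.ne']
    ring
  · rintro _ ⟨C, hC, rfl⟩
    obtain ⟨p, q, w, α, β, hp, hq, hw, rfl⟩ := exists_eq_collider hC
    rw [logLik, trace_mul_collider_inv hS hp hq hw, det_collider, log_mul_mul hp hq hw,
      log_mul_mul h0 h1 hκ]
    have hquad : S.det / (S 0 0 * S 1 1 - S 0 1 ^ 2) ≤ S 2 2 - 2 * α * S 0 2 - 2 * β * S 1 2 +
        α ^ 2 * S 0 0 + 2 * α * β * S 0 1 + β ^ 2 * S 1 1 := by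
      rw [div_le_iff₀ hm, ← sub_nonneg]
      refine (mul_nonneg_iff_of_pos_left h0).1 ?_
      have : S 0 0 * ((S 2 2 - 2 * α * S 0 2 - 2 * β * S 1 2 +
          α ^ 2 * S 0 0 + 2 * α * β * S 0 1 + β ^ 2 * S 1 1) * (S 0 0 * S 1 1 - S 0 1 ^ 2) - S.det)
          = (S 0 0 * S 1 1 - S 0 1 ^ 2) * (S 0 0 * α + S 0 1 * β - S 0 2) ^ 2 +
          ((S 0 0 * S 1 1 - S 0 1 ^ 2) * β - (S 0 0 * S 1 2 - S 0 1 * S 0 2)) ^ 2 := by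
        rw [hdetS]
        ring
      rw [this]
      positivity
    have i1 := neg_log_sub_div_le h0 le_rfl hp
    have i2 := neg_log_sub_div_le h1 le_rfl hq
    have i3 := neg_log_sub_div_le hκ hquad hw
    exact mul_le_mul_of_nonneg_left (by linarith) (by positivity)

/-- The likelihood maximum under conditional independence. -/
lemma isGreatest_logLik_model_one (n : ℕ) {S : Matrix (Fin 3) (Fin 3) ℝ} (hS : S.PosDef) :
    IsGreatest (logLik n S '' model 1)
      (n / 2 * (-Real.log ((S 0 0 * S 2 2 - S 0 2 ^ 2) / S 2 2 *
        ((S 1 1 * S 2 2 - S 1 2 ^ 2) / S 2 2) * S 2 2) - 3)) := by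
  have h2 : 0 < S 2 2 := hS.diag_pos
  have h02 := posDef_minor_pos hS (show (0 : Fin 3) ≠ 2 by decide)
  have h12 := posDef_minor_pos hS (show (1 : Fin 3) ≠ 2 by decide)
  have hp' : 0 < (S 0 0 * S 2 2 - S 0 2 ^ 2) / S 2 2 := by positivity
  have hq' : 0 < (S 1 1 * S 2 2 - S 1 2 ^ 2) / S 2 2 := by positivity
  constructor
  · refine ⟨fork _ _ _ (S 0 2 / S 2 2) (S 1 2 / S 2 2), fork_mem_model hp' hq' h2 _ _, ?_⟩
    rw [logLik, trace_mul_fork_inv hS hp' hq' h2, det_fork]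
    congr 1
    have hα : S 0 0 - 2 * (S 0 2 / S 2 2) * S 0 2 + (S 0 2 / S 2 2) ^ 2 * S 2 2 =
        (S 0 0 * S 2 2 - S 0 2 ^ 2) / S 2 2 := by
      field_simp
      ring
    have hβ : S 1 1 - 2 * (S 1 2 / S 2 2) * S 1 2 + (S 1 2 / S 2 2) ^ 2 * S 2 2 =
        (S 1 1 * S 2 2 - S 1 2 ^ 2) / S 2 2 := by
      field_simp
      ring
    rw [hα, hβ, div_self hp'.ne', div_self hq'.ne', div_self h2.ne']
    ring
  · rintro _ ⟨C, hC, rfl⟩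
    obtain ⟨p, q, w, α, β, hp, hq, hw, rfl⟩ := exists_eq_fork hC
    rw [logLik, trace_mul_fork_inv hS hp hq hw, det_fork, log_mul_mul hp hq hw,
      log_mul_mul hp' hq' h2]
    have hquad : ∀ s t x : ℝ, (s * S 2 2 - t ^ 2) / S 2 2 ≤ s - 2 * x * t + x ^ 2 * S 2 2 := by
      intro s t x
      rw [div_le_iff₀ h2]
      nlinarith [sq_nonneg (x * S 2 2 - t)]
    have i1 := neg_log_sub_div_le hp' (hquad (S 0 0) (S 0 2) α) hp
    have i2 := neg_log_sub_div_le hq' (hquad (S 1 1) (S 1 2) β) hq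
    have i3 := neg_log_sub_div_le h2 le_rfl hw
    exact mul_le_mul_of_nonneg_left (by linarith) (by positivity)

lemma bddAbove_logLik (n : ℕ) {S : Matrix (Fin 3) (Fin 3) ℝ} (hS : S.PosDef) (j : Fin 2) :
    BddAbove (logLik n S '' model j) := by
  fin_cases j
  · exact (isGreatest_logLik_model_zero n hS).bddAbove
  · exact (isGreatest_logLik_model_one n hS).bddAbove

/-- The ratio of determinants which determines the likelihood ratio. -/
noncomputable def minorRatio (S : Matrix (Fin 3) (Fin 3) ℝ) : ℝ :=
  (S 0 0 * S 1 1 - S 0 1 ^ 2) * (S 0 0 * S 2 2 - S 0 2 ^ 2) * (S 1 1 * S 2 2 - S 1 2 ^ 2) /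
    (S 0 0 * S 1 1 * S 2 2 * S.det)

lemma lrStat_eq (n : ℕ) (x : Fin n → EuclideanSpace ℝ (Fin 3)) (hS : (sampleCov n x).PosDef) :
    lrStat n x = n * Real.log (minorRatio (sampleCov n x)) := by
  rw [lrStat, maxLogLik, maxLogLik, (isGreatest_logLik_model_zero n hS).csSup_eq,
    (isGreatest_logLik_model_one n hS).csSup_eq]
  set S := sampleCov n x
  have h0 : 0 < S 0 0 := hS.diag_pos
  have h1 : 0 < S 1 1 := hS.diag_pos
  have h2 : 0 < S 2 2 := hS.diag_pos
  have h01 := posDef_minor_pos hS (show (0 : Fin 3) ≠ 1 by decide)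
  have h02 := posDef_minor_pos hS (show (0 : Fin 3) ≠ 2 by decide)
  have h12 := posDef_minor_pos hS (show (1 : Fin 3) ≠ 2 by decide)
  have hdet := hS.det_pos
  have : minorRatio S = (S 0 0 * S 2 2 - S 0 2 ^ 2) / S 2 2 *
        ((S 1 1 * S 2 2 - S 1 2 ^ 2) / S 2 2) * S 2 2 /
        (S 0 0 * S 1 1 * (S.det / (S 0 0 * S 1 1 - S 0 1 ^ 2))) := by
    rw [minorRatio]
    field_simp
  rw [this, Real.log_div (by positivity) (by positivity)]
  ring

end Likelihood

/-! ### Measurability of the statistic. -/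

section Measurability

open Matrix

/-- The supremum of a continuous function over a set is its supremum over a dense subset. -/
lemma sSup_image_eq_of_subset_closure {X : Type*} [TopologicalSpace X] {f : X → ℝ} {s t : Set X}
    (hf : ContinuousOn f s) (hts : t ⊆ s) (hst : s ⊆ closure t) :
    sSup (f '' s) = sSup (f '' t) := by
  have hsub : f '' s ⊆ closure (f '' t) := by
    rintro _ ⟨x, hx, rfl⟩
    have h1 : ContinuousWithinAt f t x := (hf x hx).mono hts
    exact h1.mem_closure_image (hst hx)
  have hub : upperBounds (f '' s) = upperBounds (f '' t) := by
    refine (upperBounds_mono_set (Set.image_mono hts)).antisymm ?_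
    rw [← upperBounds_closure (f '' t)]
    exact upperBounds_mono_set hsub
  rcases (f '' t).eq_empty_or_nonempty with he | hne
  · rw [he, closure_empty] at hsub
    rw [he, Set.subset_empty_iff.1 hsub]
  · by_cases hb : BddAbove (f '' t)
    · have hlub := (isLUB_congr hub).2 (isLUB_csSup hne hb)
      exact hlub.csSup_eq (hne.mono (Set.image_mono hts))
    -- Unbounded images, possible for singular sample covariances, receive the same default value of
    -- `sSup` on both sides.
    · have hb' : ¬ BddAbove (f '' s) := fun h => hb (h.mono (Set.image_mono hts))
      rw [Real.sSup_of_not_bddAbove hb, Real.sSup_of_not_bddAbove hb']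

lemma continuousOn_logLik (n : ℕ) (S : Matrix (Fin 3) (Fin 3) ℝ) :
    ContinuousOn (logLik n S) {C | C.PosDef} := by
  have hdet : ∀ C ∈ {C : Matrix (Fin 3) (Fin 3) ℝ | C.PosDef}, C.det ≠ 0 :=
    fun C hC => (Matrix.PosDef.det_pos hC).ne'
  have hcdet : ContinuousOn (fun C : Matrix (Fin 3) (Fin 3) ℝ => C.det) {C | C.PosDef} :=
    (continuous_id.matrix_det).continuousOn
  have hinv : ContinuousOn (fun C : Matrix (Fin 3) (Fin 3) ℝ => C⁻¹) {C | C.PosDef} := by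
    simp only [Matrix.inv_def, Ring.inverse_eq_inv']
    exact (hcdet.inv₀ hdet).smul continuous_id.matrix_adjugate.continuousOn
  have htr : ContinuousOn (fun C : Matrix (Fin 3) (Fin 3) ℝ => (S * C⁻¹).trace)
      {C | C.PosDef} :=
    (Continuous.matrix_trace (Continuous.matrix_mul continuous_const
      continuous_id)).comp_continuousOn hinv
  exact continuousOn_const.mul ((hcdet.log hdet).neg.sub htr)

lemma model_subset_posDef (j : Fin 2) : model j ⊆ {C | C.PosDef} := by
  fin_cases j
  · exact fun C hC => hC.1
  · exact fun C hC => hC.1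

lemma measurable_sampleCov_apply (n : ℕ) (j k : Fin 3) :
    Measurable fun x : Fin n → EuclideanSpace ℝ (Fin 3) => sampleCov n x j k := by
  simp only [sampleCov, Matrix.of_apply]
  fun_prop

lemma measurable_logLik (n : ℕ) (C : Matrix (Fin 3) (Fin 3) ℝ) :
    Measurable fun x : Fin n → EuclideanSpace ℝ (Fin 3) => logLik n (sampleCov n x) C := by
  have := measurable_sampleCov_apply n
  simp only [logLik, Matrix.trace, Matrix.diag, Matrix.mul_apply]
  fun_prop

/-- Continuity in the covariance reduces the supremum to a countable dense subset of the model, for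
every sample, degenerate or not. -/
lemma measurable_maxLogLik (n : ℕ) (j : Fin 2) : Measurable (maxLogLik n j) := by
  have : TopologicalSpace.SeparableSpace (Matrix (Fin 3) (Fin 3) ℝ) :=
    inferInstanceAs (TopologicalSpace.SeparableSpace (Fin 3 → Fin 3 → ℝ))
  have : TopologicalSpace.PseudoMetrizableSpace (Matrix (Fin 3) (Fin 3) ℝ) :=
    inferInstanceAs (TopologicalSpace.PseudoMetrizableSpace (Fin 3 → Fin 3 → ℝ))
  obtain ⟨t, hts, htc, hst⟩ := (TopologicalSpace.IsSeparable.of_separableSpace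
    (model j)).exists_countable_dense_subset
  have : maxLogLik n j = fun x => sSup ((fun C => logLik n (sampleCov n x) C) '' t) := by
    funext x
    exact sSup_image_eq_of_subset_closure
      ((continuousOn_logLik n _).mono (model_subset_posDef j)) hts hst
  rw [this]
  exact Measurable.sSup htc fun C _ => measurable_logLik n C

lemma measurable_lrStat (n : ℕ) : Measurable (lrStat n) :=
  ((measurable_maxLogLik n 0).sub (measurable_maxLogLik n 1)).const_mul 2

end Measurability

/-! ### Almost sure nonsingularity of the sample covariance. -/

section Nondegeneracy

open Matrix

/-- The projection on `v` is a real Gaussian of variance `vᵀCv > 0`, hence has no atom at zero. -/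
lemma ae_inner_ne_zero {C : Matrix (Fin 3) (Fin 3) ℝ} (hC : C.PosDef)
    {v : EuclideanSpace ℝ (Fin 3)} (hv : v ≠ 0) :
    ∀ᵐ x ∂multivariateGaussian 0 C, inner ℝ v x ≠ 0 := by
  have hmap := IsGaussian.map_eq_gaussianReal (μ := multivariateGaussian 0 C) (innerSL ℝ v)
  have hvar : 0 < Var[(innerSL ℝ v : EuclideanSpace ℝ (Fin 3) → ℝ);
      multivariateGaussian 0 C] := by
    have h1 := covarianceBilin_self (μ := multivariateGaussian 0 C)
      IsGaussian.memLp_two_id v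
    rw [covarianceBilin_multivariateGaussian hC.posSemidef] at h1
    have h2 : 0 < v.ofLp ⬝ᵥ C *ᵥ v.ofLp := by
      have := hC.dotProduct_mulVec_pos (x := v.ofLp) (by simpa using hv)
      simpa using this
    rw [h1] at h2
    exact h2
  have hna := nullSingletonClass_gaussianReal
    (μ := ∫ x, (innerSL ℝ v) x ∂multivariateGaussian 0 C)
    (v := Var[(innerSL ℝ v : EuclideanSpace ℝ (Fin 3) → ℝ);
      multivariateGaussian 0 C].toNNReal) (by simpa using hvar)
  rw [← hmap] at hna
  have hnull : (multivariateGaussian 0 C).map (innerSL ℝ v) {0} = 0 := measure_singleton 0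
  rw [Measure.map_apply (by fun_prop) (measurableSet_singleton 0)] at hnull
  rw [ae_iff]
  convert hnull using 2
  ext x
  simp

/-- Fubini: by independence the vector `f (Y ω)` may be frozen. -/
lemma ae_inner_ne_zero_of_indepFun {Ω E : Type*} [MeasurableSpace Ω] [MeasurableSpace E]
    {P : Measure Ω} [IsProbabilityMeasure P] {C : Matrix (Fin 3) (Fin 3) ℝ} (hC : C.PosDef)
    {Y : Ω → E} {X : Ω → EuclideanSpace ℝ (Fin 3)} {f : E → EuclideanSpace ℝ (Fin 3)}
    (hY : Measurable Y) (hX : Measurable X) (hf : Measurable f) (hind : IndepFun Y X P)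
    (hlaw : P.map X = multivariateGaussian 0 C) (hne : ∀ᵐ ω ∂P, f (Y ω) ≠ 0) :
    ∀ᵐ ω ∂P, inner ℝ (f (Y ω)) (X ω) ≠ 0 := by
  have hjoint := (indepFun_iff_map_prod_eq_prod_map_map hY.aemeasurable hX.aemeasurable).1 hind
  have hms : MeasurableSet {z : E × EuclideanSpace ℝ (Fin 3) | inner ℝ (f z.1) z.2 ≠ 0} := by
    have : Measurable fun z : E × EuclideanSpace ℝ (Fin 3) => inner ℝ (f z.1) z.2 := by fun_prop
    exact (this (measurableSet_singleton 0)).compl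
  have key : ∀ᵐ z ∂P.map fun ω => (Y ω, X ω), inner ℝ (f z.1) z.2 ≠ 0 := by
    have := Measure.isProbabilityMeasure_map (μ := P) hX.aemeasurable
    rw [hjoint, Measure.ae_prod_iff_ae_ae hms]
    have h2 : ∀ᵐ y ∂P.map Y, f y ≠ 0 := by
      rw [ae_map_iff hY.aemeasurable]
      · exact hne
      · exact (hf (measurableSet_singleton 0)).compl
    filter_upwards [h2] with y hy
    rw [hlaw]
    exact ae_inner_ne_zero hC hy
  exact ae_of_ae_map (hY.prodMk hX).aemeasurable key

lemma sampleCov_eq (n : ℕ) (x : Fin n → EuclideanSpace ℝ (Fin 3)) :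
    sampleCov n x = (n : ℝ)⁻¹ • ((Matrix.of fun m j => x m j)ᴴ * Matrix.of fun m j => x m j) := by
  ext j k
  simp [sampleCov, Matrix.mul_apply, div_eq_inv_mul]

lemma posDef_sampleCov_of_det_ne_zero {n : ℕ} (hn : 0 < n)
    (x : Fin n → EuclideanSpace ℝ (Fin 3)) (r : Fin 3 → Fin n)
    (h : (Matrix.of fun a j => x (r a) j : Matrix (Fin 3) (Fin 3) ℝ).det ≠ 0) :
    (sampleCov n x).PosDef := by
  rw [sampleCov_eq]
  refine Matrix.PosDef.smul (Matrix.PosDef.conjTranspose_mul_self _ ?_) (by positivity)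
  intro v w hvw
  rw [← sub_eq_zero]
  refine Matrix.eq_zero_of_mulVec_eq_zero h ?_
  rw [Matrix.mulVec_sub, sub_eq_zero]
  funext a
  exact congrFun hvw (r a)

/-- A sample of at least three observations has a nonsingular sample covariance. -/
lemma ae_posDef_sampleCov {n : ℕ} (hn : 3 ≤ n) {C : Matrix (Fin 3) (Fin 3) ℝ} (hC : C.PosDef) :
    ∀ᵐ x ∂sampleLaw n C, (sampleCov n x).PosDef := by
  have hind : iIndepFun (fun (m : Fin n) (x : Fin n → EuclideanSpace ℝ (Fin 3)) => x m)
      (sampleLaw n C) :=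
    iIndepFun_pi (X := fun _ (y : EuclideanSpace ℝ (Fin 3)) => y) fun _ => aemeasurable_id
  have hlaw : ∀ m : Fin n, (sampleLaw n C).map (fun x => x m) = multivariateGaussian 0 C :=
    fun m => (measurePreserving_eval (fun _ : Fin n => multivariateGaussian 0 C) m).map_eq
  have hm : ∀ m : Fin n, Measurable fun x : Fin n → EuclideanSpace ℝ (Fin 3) => x m :=
    fun m => measurable_pi_apply m
  set a : Fin n := ⟨0, by omega⟩
  set b : Fin n := ⟨1, by omega⟩
  set c : Fin n := ⟨2, by omega⟩
  have hab : a ≠ b := by simp [a, b]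
  have hac : a ≠ c := by simp [a, c]
  have hbc : b ≠ c := by simp [b, c]
  have h1 : ∀ᵐ x ∂sampleLaw n C, x a 0 ≠ 0 := by
    have hv : (EuclideanSpace.single 0 1 : EuclideanSpace ℝ (Fin 3)) ≠ 0 := by simp
    have := ae_inner_ne_zero hC hv
    rw [← hlaw a] at this
    filter_upwards [ae_of_ae_map (hm a).aemeasurable this] with x hx
    simpa [EuclideanSpace.inner_single_left] using hx
  -- The minor is the inner product of `x b` with a vector depending only on `x a`, nonzero by `h1`.
  have h2 : ∀ᵐ x ∂sampleLaw n C, x a 0 * x b 1 - x a 1 * x b 0 ≠ 0 := by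
    have := ae_inner_ne_zero_of_indepFun hC (hm a) (hm b)
      (f := fun y => !₂[-y 1, y 0, 0]) (by fun_prop) (hind.indepFun hab) (hlaw b) (by
        filter_upwards [h1] with x hx h0
        exact hx (by simpa using congrArg (fun v : EuclideanSpace ℝ (Fin 3) => v 1) h0))
    filter_upwards [this] with x hx
    simp [PiLp.inner_apply, Fin.sum_univ_three] at hx
    contrapose! hx
    linarith
  -- Here `f` is the cross product of `x a` and `x b`, so the inner product with `x c` is the `3 ×
  -- 3` determinant. Its last component is the minor of `h2`.
  have h3 := ae_inner_ne_zero_of_indepFun hC ((hm a).prodMk (hm b)) (hm c)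
      (f := fun y => !₂[y.1 1 * y.2 2 - y.1 2 * y.2 1, y.1 2 * y.2 0 - y.1 0 * y.2 2,
        y.1 0 * y.2 1 - y.1 1 * y.2 0]) (by fun_prop) (hind.indepFun_prodMk hm a b c hac hbc)
      (hlaw c) (by
        filter_upwards [h2] with x hx h0
        exact hx (by simpa using congrArg (fun v : EuclideanSpace ℝ (Fin 3) => v 2) h0))
  filter_upwards [h3] with x hx
  refine posDef_sampleCov_of_det_ne_zero (by omega) x ![a, b, c] ?_
  simp [PiLp.inner_apply, Fin.sum_univ_three] at hx
  rw [Matrix.det_fin_three]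
  simp
  contrapose! hx
  linarith

end Nondegeneracy

/-! ### Deterministic expansion of the log ratio along a filter. -/

section Expansion

open Matrix

variable {α : Type*} {l : Filter α}

lemma tendsto_mul_zero_of_isBigO_one {f g : α → ℝ} (hf : f =O[l] fun _ => (1 : ℝ))
    (hg : Tendsto g l (𝓝 0)) : Tendsto (fun x => f x * g x) l (𝓝 0) := by
  have hg' := (isLittleO_one_iff ℝ).2 hg
  have := hf.mul_isLittleO hg'
  simp only [mul_one] at this
  exact (isLittleO_one_iff ℝ).1 this

lemma isBigO_one_of_tendsto_sub {f g : α → ℝ} (hg : g =O[l] fun _ => (1 : ℝ))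
    (h : Tendsto (fun x => f x - g x) l (𝓝 0)) : f =O[l] fun _ => (1 : ℝ) := by
  have := (h.isBigO_one ℝ).add hg
  simpa using this

lemma tendsto_matrix_apply {S : α → Matrix (Fin 3) (Fin 3) ℝ} {B : Matrix (Fin 3) (Fin 3) ℝ}
    (h : Tendsto S l (𝓝 B)) (j k : Fin 3) : Tendsto (fun x => S x j k) l (𝓝 (B j k)) :=
  (h.apply_nhds j).apply_nhds k

/-- `N log (1 + y)` may be replaced by `N y` when the latter is bounded. -/
lemma tendsto_mul_log_one_add_sub {M y : α → ℝ} (hM : Tendsto M l atTop)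
    (hy : (fun x => M x * y x) =O[l] fun _ => (1 : ℝ)) :
    Tendsto (fun x => M x * Real.log (1 + y x) - M x * y x) l (𝓝 0) := by
  have hy0 : Tendsto y l (𝓝 0) := by
    have h := tendsto_mul_zero_of_isBigO_one hy (tendsto_inv_atTop_zero.comp hM)
    refine h.congr' ?_
    filter_upwards [hM.eventually_ne_atTop 0] with x hx
    simp only [Function.comp_apply]
    field_simp
  have hd : HasDerivAt (fun z : ℝ => Real.log (1 + z)) 1 0 := by
    have h1 : HasDerivAt (fun z : ℝ => 1 + z) 1 0 := (hasDerivAt_id (0 : ℝ)).const_add 1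
    simpa using h1.log (by simp)
  have h2 := (hasDerivAt_iff_isLittleO.1 hd).comp_tendsto hy0
  have h3 : (fun x => Real.log (1 + y x) - y x) =o[l] y := by
    simpa [Function.comp_def] using h2
  have h4 := (isBigO_refl M l).mul_isLittleO h3
  have h5 := h4.trans_isBigO hy
  refine ((isLittleO_one_iff ℝ).1 h5).congr fun x => ?_
  ring

/-- Expansion of the likelihood ratio near independence. -/
lemma tendsto_mul_log_minorRatio_sub {N : α → ℕ} (hN : Tendsto N l atTop)
    {S : α → Matrix (Fin 3) (Fin 3) ℝ} (hsymm : ∀ x, (S x).IsSymm) (hS : Tendsto S l (𝓝 1))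
    {δ : ℝ} (hU : (fun x => √(N x) * S x 0 1) =O[l] fun _ => (1 : ℝ))
    (hT : Tendsto (fun x => √(N x) * (S x 0 2 * S x 1 2)) l (𝓝 δ)) :
    (∀ᶠ x in l, (S x).PosDef) ∧
    Tendsto (fun x => N x * Real.log (minorRatio (S x)) -
      (δ ^ 2 - 2 * δ * (√(N x) * S x 0 1))) l (𝓝 0) := by
  have hent : ∀ j k, Tendsto (fun x => S x j k) l (𝓝 ((1 : Matrix (Fin 3) (Fin 3) ℝ) j k)) :=
    tendsto_matrix_apply hS
  have h00 : Tendsto (fun x => S x 0 0) l (𝓝 1) := by simpa using hent 0 0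
  have h11 : Tendsto (fun x => S x 1 1) l (𝓝 1) := by simpa using hent 1 1
  have h22 : Tendsto (fun x => S x 2 2) l (𝓝 1) := by simpa using hent 2 2
  have h01 : Tendsto (fun x => S x 0 1) l (𝓝 0) := by simpa using hent 0 1
  have h02 : Tendsto (fun x => S x 0 2) l (𝓝 0) := by simpa using hent 0 2
  have h12 : Tendsto (fun x => S x 1 2) l (𝓝 0) := by simpa using hent 1 2
  have hdet : Tendsto (fun x => (S x).det) l (𝓝 1) := by
    simpa [Function.comp_def] using (continuous_id.matrix_det (R := ℝ)).continuousAt.tendsto.comp hS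
  have hdetS : ∀ x, (S x).det = S x 0 0 * S x 1 1 * S x 2 2 - S x 0 0 * S x 1 2 ^ 2
      - S x 1 1 * S x 0 2 ^ 2 - S x 2 2 * S x 0 1 ^ 2 + 2 * S x 0 1 * S x 0 2 * S x 1 2 := by
    intro x
    rw [Matrix.det_fin_three, (hsymm x).apply 0 1, (hsymm x).apply 0 2, (hsymm x).apply 1 2]
    ring
  have hD : Tendsto (fun x => S x 0 0 * S x 1 1 * S x 2 2 * (S x).det) l (𝓝 1) := by
    simpa using ((h00.mul h11).mul h22).mul hdet
  constructor
  · have hminor : Tendsto (fun x => S x 0 0 * S x 1 1 - S x 0 1 ^ 2) l (𝓝 1) := by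
      simpa using (h00.mul h11).sub (h01.pow 2)
    filter_upwards [h00.eventually_const_lt one_pos, hminor.eventually_const_lt one_pos,
      hdet.eventually_const_lt one_pos] with x h1 h2 h3
    exact posDef_of_minors ((hsymm x).apply 0 1) ((hsymm x).apply 0 2) ((hsymm x).apply 1 2)
      h1 h2 h3
  · set U : α → ℝ := fun x => √(N x) * S x 0 1 with hUdef
    set T : α → ℝ := fun x => √(N x) * (S x 0 2 * S x 1 2) with hTdef
    set D : α → ℝ := fun x => S x 0 0 * S x 1 1 * S x 2 2 * (S x).det with hDdef
    set y : α → ℝ := fun x => minorRatio (S x) - 1 with hydef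
    have hU2 : (fun x => U x ^ 2) =O[l] fun _ => (1 : ℝ) := by
      simpa [sq] using hU.mul hU
    -- The error in `N y ≈ δ² - 2δU` splits into three pieces: terms carrying `U²` (`hsmall`), the
    -- `T²` term (`hmain`) and the cross term in `U T` (`hlin`).
    have hsmall := tendsto_mul_zero_of_isBigO_one hU2
      (show Tendsto (fun x => (S x 0 2 ^ 2 * S x 1 1 * S x 2 2 + S x 1 2 ^ 2 * S x 0 0 * S x 2 2
        - S x 0 2 ^ 2 * S x 1 2 ^ 2) / D x) l (𝓝 0) by
        simpa [Pi.div_def] using (((((h02.pow 2).mul h11).mul h22).add (((h12.pow 2).mul h00).mul h22)).sub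
          ((h02.pow 2).mul (h12.pow 2))).div hD one_ne_zero)
    have hmain : Tendsto (fun x => T x ^ 2 * S x 0 0 * S x 1 1 / D x - δ ^ 2) l (𝓝 0) := by
      rw [tendsto_sub_nhds_zero_iff]
      simpa [Pi.div_def] using (((hT.pow 2).mul h00).mul h11).div hD one_ne_zero
    have hlin := tendsto_mul_zero_of_isBigO_one hU
      (show Tendsto (fun x => 2 * (δ - S x 0 0 * S x 1 1 * S x 2 2 * T x / D x)) l (𝓝 0) by
        simpa using (((((h00.mul h11).mul h22).mul hT).div hD one_ne_zero).const_sub δ).const_mul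
          2)
    have hNy : Tendsto (fun x => N x * y x - (δ ^ 2 - 2 * δ * U x)) l (𝓝 0) := by
      have := (hsmall.add hmain).add hlin
      simp only [add_zero] at this
      refine this.congr' ?_
      filter_upwards [hD.eventually_ne one_ne_zero] with x hx
      have hsq : (N x : ℝ) = √(N x) ^ 2 := (Real.sq_sqrt (Nat.cast_nonneg _)).symm
      have hy' : y x = (S x 0 1 ^ 2 * S x 0 2 ^ 2 * S x 1 1 * S x 2 2
          + S x 0 1 ^ 2 * S x 1 2 ^ 2 * S x 0 0 * S x 2 2
          + S x 0 2 ^ 2 * S x 1 2 ^ 2 * S x 0 0 * S x 1 1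
          - S x 0 1 ^ 2 * S x 0 2 ^ 2 * S x 1 2 ^ 2
          - 2 * S x 0 0 * S x 1 1 * S x 2 2 * S x 0 1 * S x 0 2 * S x 1 2) / D x := by
        simp only [hydef, minorRatio]
        change _ / D x - 1 = _
        rw [div_sub_one hx]
        congr 1
        simp only [hDdef]
        rw [hdetS]
        ring
      rw [hy', hsq]
      simp only [hUdef, hTdef]
      field_simp
      ring
    have hbdd : (fun x => N x * y x) =O[l] fun _ => (1 : ℝ) := by
      refine isBigO_one_of_tendsto_sub ?_ hNy
      exact (isBigO_const_const _ one_ne_zero _).sub (hU.const_mul_left _)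
    have hlog := tendsto_mul_log_one_add_sub (tendsto_natCast_atTop_atTop.comp hN) hbdd
    have := hlog.add hNy
    simp only [add_zero] at this
    refine this.congr fun x => ?_
    simp only [hydef, Function.comp_apply, add_sub_cancel]
    ring

/-- The likelihood ratio for a sample covariance which is a fluctuation of order `N^(-1/2)`
around `A Aᵀ`. -/
lemma tendsto_mul_log_minorRatio_perturbation {N : α → ℕ} (hN : Tendsto N l atTop)
    {A : ℕ → Matrix (Fin 3) (Fin 3) ℝ} (hA : Tendsto A atTop (𝓝 1)) {c δ : ℝ}
    (h01 : Tendsto (fun n : ℕ => √n * (A n * (A n)ᵀ) 0 1) atTop (𝓝 c))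
    (hprod : Tendsto (fun n : ℕ => √n * ((A n * (A n)ᵀ) 0 2 * (A n * (A n)ᵀ) 1 2)) atTop (𝓝 δ))
    {G : α → Matrix (Fin 3) (Fin 3) ℝ} (hsymm : ∀ x, (G x).IsSymm)
    (hG : ∀ j k, (fun x => G x j k) =O[l] fun _ => (1 : ℝ)) :
    (∀ᶠ x in l, (A (N x) * (1 + (√(N x))⁻¹ • G x) * (A (N x))ᵀ).PosDef) ∧
    Tendsto (fun x => N x * Real.log (minorRatio
      (A (N x) * (1 + (√(N x))⁻¹ • G x) * (A (N x))ᵀ)) -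
      (δ ^ 2 - 2 * δ * (c + G x 0 1))) l (𝓝 0) := by
  set K : α → Matrix (Fin 3) (Fin 3) ℝ := fun x => A (N x) * G x * (A (N x))ᵀ with hK
  set R : α → Matrix (Fin 3) (Fin 3) ℝ := fun x => A (N x) * (A (N x))ᵀ with hR
  set S : α → Matrix (Fin 3) (Fin 3) ℝ :=
    fun x => A (N x) * (1 + (√(N x))⁻¹ • G x) * (A (N x))ᵀ with hSdef
  have hS : ∀ x, S x = R x + (√(N x))⁻¹ • K x := by
    intro x
    simp [hSdef, hR, hK, Matrix.mul_add, Matrix.add_mul]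
  have hSapp : ∀ x j k, S x j k = R x j k + (√(N x))⁻¹ * K x j k := by
    intro x j k
    simp [hS]
  have hroot : Tendsto (fun x => √(N x : ℝ)) l atTop :=
    Real.tendsto_sqrt_atTop.comp (tendsto_natCast_atTop_atTop.comp hN)
  have hinv : Tendsto (fun x => (√(N x : ℝ))⁻¹) l (𝓝 0) := tendsto_inv_atTop_zero.comp hroot
  have hAent : ∀ j k, Tendsto (fun x => A (N x) j k) l
      (𝓝 ((1 : Matrix (Fin 3) (Fin 3) ℝ) j k)) :=
    tendsto_matrix_apply (hA.comp hN)
  -- Since `A → 1` and `G` is bounded, conjugation by `A` does not change the fluctuation in the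
  -- limit.
  have hKG : ∀ j k, Tendsto (fun x => K x j k - G x j k) l (𝓝 0) := by
    intro j k
    have h1 : ∀ p q, Tendsto (fun x => G x p q * (A (N x) j p * A (N x) k q -
        (1 : Matrix (Fin 3) (Fin 3) ℝ) j p * (1 : Matrix (Fin 3) (Fin 3) ℝ) k q)) l (𝓝 0) := by
      intro p q
      refine tendsto_mul_zero_of_isBigO_one (hG p q) ?_
      simpa using ((hAent j p).mul (hAent k q)).sub_const
        ((1 : Matrix (Fin 3) (Fin 3) ℝ) j p * (1 : Matrix (Fin 3) (Fin 3) ℝ) k q)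
    have h2 := tendsto_finsetSum Finset.univ fun q _ => tendsto_finsetSum Finset.univ
      fun p _ => h1 p q
    simp only [Finset.sum_const_zero] at h2
    refine h2.congr fun x => ?_
    have h3 : K x j k = ∑ q, ∑ p, G x p q * (A (N x) j p * A (N x) k q) := by
      simp only [hK, Matrix.mul_apply, Matrix.transpose_apply, Finset.sum_mul]
      exact Finset.sum_congr rfl fun q _ => Finset.sum_congr rfl fun p _ => by ring
    have h4 : G x j k = ∑ q, ∑ p, G x p q * ((1 : Matrix (Fin 3) (Fin 3) ℝ) j p *
        (1 : Matrix (Fin 3) (Fin 3) ℝ) k q) := by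
      simp [Matrix.one_apply]
    rw [h3, h4, ← Finset.sum_sub_distrib]
    refine Finset.sum_congr rfl fun q _ => ?_
    rw [← Finset.sum_sub_distrib]
    exact Finset.sum_congr rfl fun p _ => by ring
  have hKO : ∀ j k, (fun x => K x j k) =O[l] fun _ => (1 : ℝ) :=
    fun j k => isBigO_one_of_tendsto_sub (hG j k) (hKG j k)
  have hRlim : Tendsto R l (𝓝 1) := by
    have h1 : Tendsto (fun n => A n * (A n)ᵀ) atTop (𝓝 1) := by
      have := (continuous_id.matrix_mul (continuous_id.matrix_transpose
        (R := ℝ) (m := Fin 3) (n := Fin 3))).continuousAt.tendsto.comp hA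
      simpa [Function.comp_def] using this
    exact h1.comp hN
  have hRent : ∀ j k, Tendsto (fun x => R x j k) l
      (𝓝 ((1 : Matrix (Fin 3) (Fin 3) ℝ) j k)) :=
    tendsto_matrix_apply hRlim
  have hSlim : Tendsto S l (𝓝 1) := by
    refine tendsto_pi_nhds.2 fun j => tendsto_pi_nhds.2 fun k => ?_
    have h1 := (hRent j k).add (tendsto_mul_zero_of_isBigO_one (hKO j k) hinv)
    rw [add_zero] at h1
    exact h1.congr fun x => by rw [hSapp, mul_comm]
  have hSsymm : ∀ x, (S x).IsSymm := by
    intro x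
    simp [Matrix.IsSymm, hSdef, Matrix.transpose_mul, (hsymm x).eq, Matrix.mul_assoc]
  have hUsub : Tendsto (fun x => √(N x) * S x 0 1 - (c + G x 0 1)) l (𝓝 0) := by
    have h1 := ((h01.comp hN).sub_const c).add (hKG 0 1)
    simp only [sub_self, add_zero] at h1
    refine h1.congr' ?_
    filter_upwards [hroot.eventually_ne_atTop 0] with x hx
    rw [hSapp]
    simp only [Function.comp_apply, hR]
    field_simp
    ring
  have hU : (fun x => √(N x) * S x 0 1) =O[l] fun _ => (1 : ℝ) :=
    isBigO_one_of_tendsto_sub ((isBigO_const_const _ one_ne_zero _).add (hG 0 1)) hUsub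
  -- Expand the product: the mixed terms `R K` vanish because `R 0 2, R 1 2 → 0` with `K` bounded,
  -- and `K K` keeps a factor `N^(-1/2)`. No rate for `R 0 2` or `R 1 2` separately is needed.
  have hT : Tendsto (fun x => √(N x) * (S x 0 2 * S x 1 2)) l (𝓝 δ) := by
    have h02 : Tendsto (fun x => R x 0 2) l (𝓝 0) := by simpa using hRent 0 2
    have h12 : Tendsto (fun x => R x 1 2) l (𝓝 0) := by simpa using hRent 1 2
    have hKK : (fun x => K x 0 2 * K x 1 2) =O[l] fun _ => (1 : ℝ) := by
      simpa using (hKO 0 2).mul (hKO 1 2)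
    have h1 := (((hprod.comp hN).add (tendsto_mul_zero_of_isBigO_one (hKO 1 2) h02)).add
      (tendsto_mul_zero_of_isBigO_one (hKO 0 2) h12)).add
      (tendsto_mul_zero_of_isBigO_one hKK hinv)
    simp only [add_zero] at h1
    refine h1.congr' ?_
    filter_upwards [hroot.eventually_ne_atTop 0] with x hx
    rw [hSapp, hSapp]
    simp only [Function.comp_apply]
    change √(N x : ℝ) * (R x 0 2 * R x 1 2) + _ + _ + _ = _
    field_simp
    ring
  obtain ⟨hpd, hlim⟩ := tendsto_mul_log_minorRatio_sub hN hSsymm hSlim hU hT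
  refine ⟨hpd, ?_⟩
  have := hlim.sub (hUsub.const_mul (2 * δ))
  simp only [mul_zero, sub_zero] at this
  refine this.congr fun x => ?_
  ring

end Expansion

/-! ### Central limit theorem and tightness for the noise. -/

section Noise

open Matrix

/-- The law of three independent standard normal variables. -/
noncomputable def stdLaw : Measure (Fin 3 → ℝ) := Measure.pi fun _ => gaussianReal 0 1

instance : IsProbabilityMeasure stdLaw := by
  unfold stdLaw
  infer_instance

/-- The law of an infinite sequence of independent standard normal vectors. -/
noncomputable def noiseLaw : Measure (ℕ → Fin 3 → ℝ) := Measure.infinitePi fun _ => stdLaw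

instance : IsProbabilityMeasure noiseLaw := by
  unfold noiseLaw
  infer_instance

/-- The centred product of two coordinates of a standard normal vector. -/
def prodDev (j k : Fin 3) (z : Fin 3 → ℝ) : ℝ := z j * z k - (1 : Matrix (Fin 3) (Fin 3) ℝ) j k

lemma measurable_prodDev (j k : Fin 3) : Measurable (prodDev j k) := by
  unfold prodDev
  fun_prop

lemma stdLaw_map_eval (j : Fin 3) : stdLaw.map (fun z => z j) = gaussianReal 0 1 :=
  (measurePreserving_eval (fun _ : Fin 3 => gaussianReal 0 1) j).map_eq

lemma memLp_eval_stdLaw (j : Fin 3) (p : NNReal) : MemLp (fun z : Fin 3 → ℝ => z j) p stdLaw := by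
  have h := memLp_id_gaussianReal (μ := 0) (v := 1) p
  rw [← stdLaw_map_eval j] at h
  exact (memLp_map_measure_iff aestronglyMeasurable_id (measurable_pi_apply j).aemeasurable).1 h

lemma memLp_prodDev (j k : Fin 3) : MemLp (prodDev j k) 2 stdLaw := by
  have : ENNReal.HolderTriple ((4 : NNReal) : ENNReal) ((4 : NNReal) : ENNReal) 2 := by
    constructor
    have h4 : ((4 : NNReal) : ENNReal) = 2 * 2 := by norm_num
    rw [h4, ENNReal.mul_inv (by simp) (by simp), ← mul_add, ENNReal.inv_two_add_inv_two, mul_one]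
  have h := (memLp_eval_stdLaw k 4).mul (memLp_eval_stdLaw j 4) (r := 2)
  exact h.sub (memLp_const _)

lemma indepFun_eval_stdLaw {j k : Fin 3} (h : j ≠ k) :
    IndepFun (fun z : Fin 3 → ℝ => z j) (fun z => z k) stdLaw :=
  (iIndepFun_pi (μ := fun _ : Fin 3 => gaussianReal 0 1) (X := fun _ (y : ℝ) => y)
    fun _ => aemeasurable_id).indepFun h

lemma integral_sq_gaussianReal : ∫ x : ℝ, x ^ 2 ∂gaussianReal 0 1 = 1 := by
  have h1 := variance_of_integral_eq_zero (X := fun x : ℝ => x) (μ := gaussianReal 0 1)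
    aemeasurable_id (by simp)
  rw [← h1, variance_fun_id_gaussianReal]
  simp

lemma integral_eval_sq_stdLaw (j : Fin 3) : ∫ z, z j ^ 2 ∂stdLaw = 1 := by
  rw [← integral_sq_gaussianReal, ← stdLaw_map_eval j, integral_map (measurable_pi_apply j).aemeasurable (by fun_prop)]

lemma integral_eval_stdLaw (j : Fin 3) : ∫ z, z j ∂stdLaw = 0 := by
  have h : ∫ x : ℝ, x ∂gaussianReal 0 1 = 0 := by simp
  rw [← h, ← stdLaw_map_eval j, integral_map (measurable_pi_apply j).aemeasurable (by fun_prop)]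

lemma integral_prodDev (j k : Fin 3) : ∫ z, prodDev j k z ∂stdLaw = 0 := by
  by_cases h : j = k
  · subst h
    have hi : Integrable (fun z : Fin 3 → ℝ => z j ^ 2) stdLaw :=
      (memLp_eval_stdLaw j 2).integrable_sq
    simp only [prodDev, Matrix.one_apply_eq, ← sq]
    rw [integral_sub hi (integrable_const _), integral_eval_sq_stdLaw]
    simp
  · have := (indepFun_eval_stdLaw h).integral_mul_eq_mul_integral
      (Measurable.aestronglyMeasurable (by fun_prop))
      (Measurable.aestronglyMeasurable (by fun_prop))
    simp only [prodDev, Matrix.one_apply_ne h, sub_zero]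
    simpa [integral_eval_stdLaw] using this

lemma integral_prodDev_sq : ∫ z, prodDev 0 1 z ^ 2 ∂stdLaw = 1 := by
  have hind := (indepFun_eval_stdLaw (show (0 : Fin 3) ≠ 1 by decide)).comp
    (φ := fun x : ℝ => x ^ 2) (ψ := fun x : ℝ => x ^ 2) (by fun_prop) (by fun_prop)
  have := hind.integral_mul_eq_mul_integral
      (Measurable.aestronglyMeasurable (by fun_prop))
      (Measurable.aestronglyMeasurable (by fun_prop))
  simpa [prodDev, Function.comp_def, mul_pow, integral_eval_sq_stdLaw] using this

lemma noiseLaw_map_eval (m : ℕ) : noiseLaw.map (fun ω => ω m) = stdLaw :=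
  Measure.infinitePi_map_eval (fun _ : ℕ => stdLaw) m

lemma identDistrib_prodDev (j k : Fin 3) (m : ℕ) :
    IdentDistrib (fun ω : ℕ → Fin 3 → ℝ => prodDev j k (ω m)) (prodDev j k) noiseLaw stdLaw := by
  have hm := measurable_prodDev j k
  refine ⟨Measurable.aemeasurable (by fun_prop), hm.aemeasurable, ?_⟩
  rw [← noiseLaw_map_eval m, Measure.map_map hm (by fun_prop)]
  rfl

lemma iIndepFun_prodDev (j k : Fin 3) :
    iIndepFun (fun m (ω : ℕ → Fin 3 → ℝ) => prodDev j k (ω m)) noiseLaw :=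
  iIndepFun_infinitePi (X := fun _ => prodDev j k) fun _ => measurable_prodDev j k

/-- The normalized fluctuation of the sample covariance of the first `n` noise vectors. -/
noncomputable def fluct (n : ℕ) (ω : ℕ → Fin 3 → ℝ) : Matrix (Fin 3) (Fin 3) ℝ :=
  Matrix.of fun j k => (√n)⁻¹ * ∑ m ∈ Finset.range n, prodDev j k (ω m)

lemma fluct_isSymm (n : ℕ) (ω : ℕ → Fin 3 → ℝ) : (fluct n ω).IsSymm := by
  ext j k
  simp only [fluct, Matrix.transpose_apply, Matrix.of_apply, prodDev]
  congr 1
  refine Finset.sum_congr rfl fun m _ => ?_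
  rw [mul_comm, Matrix.one_apply, Matrix.one_apply]
  simp only [eq_comm]

/-- The central limit theorem for the fluctuation of an off-diagonal entry. -/
lemma tendstoInDistribution_fluct {Ω' : Type*} [MeasurableSpace Ω'] {P' : Measure Ω'}
    [IsProbabilityMeasure P'] {Y : Ω' → ℝ} (hY : HasLaw Y (gaussianReal 0 1) P') :
    TendstoInDistribution (fun n ω => fluct n ω 0 1) atTop Y (fun _ => noiseLaw) P' := by
  refine tendstoInDistribution_inv_sqrt_mul_sum
    (X := fun m (ω : ℕ → Fin 3 → ℝ) => prodDev 0 1 (ω m)) hY ?_ ?_ (iIndepFun_prodDev 0 1) ?_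
  · rw [(identDistrib_prodDev 0 1 0).integral_eq, integral_prodDev]
  · have := ((identDistrib_prodDev 0 1 0).comp (u := fun x : ℝ => x ^ 2)
      (by fun_prop)).integral_eq
    simp only [Function.comp_def] at this
    simp only [Pi.pow_apply]
    rw [this, integral_prodDev_sq]
  · exact fun m => (identDistrib_prodDev 0 1 m).trans (identDistrib_prodDev 0 1 0).symm

/-- Chebyshev: the normalization makes the variance of the fluctuation independent of `n`. -/
lemma noiseLaw_fluct_ge_le {n : ℕ} (hn : 0 < n) (j k : Fin 3) {M : ℝ} (hM : 0 < M) :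
    noiseLaw {ω | M ≤ |fluct n ω j k|} ≤ ENNReal.ofReal (Var[prodDev j k; stdLaw] / M ^ 2) := by
  have hmem : ∀ m, MemLp (fun ω : ℕ → Fin 3 → ℝ => prodDev j k (ω m)) 2 noiseLaw :=
    fun m => (identDistrib_prodDev j k m).memLp_iff.2 (memLp_prodDev j k)
  have hsum : MemLp (fun ω : ℕ → Fin 3 → ℝ => ∑ m ∈ Finset.range n, prodDev j k (ω m)) 2
      noiseLaw := memLp_finsetSum _ fun m _ => hmem m
  have hL : MemLp (fun ω => fluct n ω j k) 2 noiseLaw := by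
    simpa [fluct] using hsum.const_mul (√n)⁻¹
  have hmean : ∫ ω, fluct n ω j k ∂noiseLaw = 0 := by
    simp only [fluct, Matrix.of_apply]
    rw [integral_const_mul, integral_finsetSum _ fun m _ => (hmem m).integrable (by simp)]
    simp [(identDistrib_prodDev j k _).integral_eq, integral_prodDev]
  have hvar : Var[fun ω => fluct n ω j k; noiseLaw] = Var[prodDev j k; stdLaw] := by
    simp only [fluct, Matrix.of_apply]
    rw [variance_const_mul]
    have h1 := IndepFun.variance_sum (μ := noiseLaw) (s := Finset.range n)
      (X := fun m (ω : ℕ → Fin 3 → ℝ) => prodDev j k (ω m)) (fun m _ => hmem m)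
      (fun a _ b _ hab => (iIndepFun_prodDev j k).indepFun hab)
    have h2 : (∑ m ∈ Finset.range n, fun ω : ℕ → Fin 3 → ℝ => prodDev j k (ω m)) =
        fun ω => ∑ m ∈ Finset.range n, prodDev j k (ω m) := by
      ext ω
      simp
    rw [h2] at h1
    rw [h1]
    simp only [(identDistrib_prodDev j k _).variance_eq, Finset.sum_const, Finset.card_range,
      nsmul_eq_mul]
    have : (0 : ℝ) < n := by exact_mod_cast hn
    rw [inv_pow, Real.sq_sqrt this.le]
    field_simp
  have h := meas_ge_le_variance_div_sq hL hM
  rw [hmean, hvar] at h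
  simpa using h

/-- The fluctuations are tight. -/
lemma exists_noiseLaw_fluct_le {ε : ENNReal} (hε : 0 < ε) :
    ∃ M : ℝ, ∀ n : ℕ, 0 < n → noiseLaw {ω | ∃ j k, M ≤ |fluct n ω j k|} ≤ ε := by
  have hlim : Tendsto (fun M : ℝ => ∑ p : Fin 3 × Fin 3,
      ENNReal.ofReal (Var[prodDev p.1 p.2; stdLaw] / M ^ 2)) atTop (𝓝 0) := by
    have h1 : ∀ p : Fin 3 × Fin 3, Tendsto (fun M : ℝ =>
        ENNReal.ofReal (Var[prodDev p.1 p.2; stdLaw] / M ^ 2)) atTop (𝓝 0) := by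
      intro p
      rw [← ENNReal.ofReal_zero]
      exact ENNReal.tendsto_ofReal (tendsto_const_nhds.div_atTop (tendsto_pow_atTop two_ne_zero))
    simpa using tendsto_finsetSum Finset.univ fun p _ => h1 p
  obtain ⟨M, hM, hpos⟩ := ((hlim.eventually_le_const hε).and (eventually_gt_atTop 0)).exists
  refine ⟨M, fun n hn => ?_⟩
  have hsub : {ω | ∃ j k, M ≤ |fluct n ω j k|} ⊆
      ⋃ p : Fin 3 × Fin 3, {ω | M ≤ |fluct n ω p.1 p.2|} := by
    rintro ω ⟨j, k, h⟩
    exact Set.mem_iUnion.2 ⟨(j, k), h⟩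
  calc noiseLaw {ω | ∃ j k, M ≤ |fluct n ω j k|}
      ≤ ∑ p : Fin 3 × Fin 3, noiseLaw {ω | M ≤ |fluct n ω p.1 p.2|} :=
        (measure_mono hsub).trans (measure_iUnion_fintype_le _ _)
    _ ≤ _ := Finset.sum_le_sum fun p _ => noiseLaw_fluct_ge_le hn p.1 p.2 hpos
    _ ≤ ε := hM

end Noise

/-! ### Realizing every sample on one noise space. -/

section Coupling

open Matrix

/-- The data built from the noise by the linear map `B`. -/
noncomputable def linearSample (n : ℕ) (B : Matrix (Fin 3) (Fin 3) ℝ) (ω : ℕ → Fin 3 → ℝ) :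
    Fin n → EuclideanSpace ℝ (Fin 3) :=
  fun m => WithLp.toLp 2 (B *ᵥ ω m)

/-- Gaussian laws are determined by mean and covariance. -/
lemma stdGaussian_map_toEuclideanCLM (B : Matrix (Fin 3) (Fin 3) ℝ) :
    (stdGaussian (EuclideanSpace ℝ (Fin 3))).map (Matrix.toEuclideanCLM (𝕜 := ℝ) B) =
      multivariateGaussian 0 (B * Bᵀ) := by
  have hpsd : (B * Bᵀ).PosSemidef := by
    simpa using Matrix.posSemidef_self_mul_conjTranspose B
  refine IsGaussian.ext ?_ ?_
  · simp only [id_eq]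
    rw [ContinuousLinearMap.integral_id_map IsGaussian.integrable_id]
    simp
  · ext u v
    have hadj : (Matrix.toEuclideanCLM (𝕜 := ℝ) B).adjoint =
        Matrix.toEuclideanCLM (𝕜 := ℝ) Bᵀ := by
      rw [← ContinuousLinearMap.star_eq_adjoint, ← map_star, Matrix.star_eq_conjTranspose,
        Matrix.conjTranspose_eq_transpose_of_trivial]
    rw [covarianceBilin_map IsGaussian.memLp_two_id, covarianceBilin_stdGaussian,
      innerSL_apply_apply, ContinuousLinearMap.adjoint_inner_left, hadj,
      Matrix.inner_toEuclideanCLM, Matrix.ofLp_toEuclideanCLM,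
      covarianceBilin_multivariateGaussian hpsd, Matrix.mulVec_mulVec]

lemma stdLaw_map_mulVec (B : Matrix (Fin 3) (Fin 3) ℝ) :
    stdLaw.map (fun z => (WithLp.toLp 2 (B *ᵥ z) : EuclideanSpace ℝ (Fin 3))) =
      multivariateGaussian 0 (B * Bᵀ) := by
  rw [← stdGaussian_map_toEuclideanCLM, ← map_pi_eq_stdGaussian,
    Measure.map_map (by fun_prop) (by fun_prop)]
  rfl

lemma measurable_toLp_mulVec (B : Matrix (Fin 3) (Fin 3) ℝ) :
    Measurable fun z : Fin 3 → ℝ => (WithLp.toLp 2 (B *ᵥ z) : EuclideanSpace ℝ (Fin 3)) := by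
  have h : Measurable fun z : Fin 3 → ℝ => B *ᵥ z := by
    refine measurable_pi_lambda _ fun j => ?_
    simp only [Matrix.mulVec, dotProduct]
    fun_prop
  exact (WithLp.measurable_toLp 2 (Fin 3 → ℝ)).comp h

lemma measurable_linearSample (n : ℕ) (B : Matrix (Fin 3) (Fin 3) ℝ) :
    Measurable (linearSample n B) :=
  measurable_pi_lambda _ fun _ => (measurable_toLp_mulVec B).comp (measurable_pi_apply _)

lemma noiseLaw_map_linearSample (n : ℕ) (B : Matrix (Fin 3) (Fin 3) ℝ) :
    noiseLaw.map (linearSample n B) = sampleLaw n (B * Bᵀ) := by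
  have h1 : noiseLaw.map (fun ω (m : Fin n) => ω m) = Measure.pi fun _ => stdLaw := by
    rw [← Measure.infinitePi_eq_pi]
    exact Measure.map_infinitePi_infinitePi_of_inj (P := fun _ : ℕ => stdLaw)
      (f := fun m : Fin n => (m : ℕ)) Fin.val_injective
  have hm := measurable_toLp_mulVec B
  have : ∀ _ : Fin n, SigmaFinite (stdLaw.map
      fun z => (WithLp.toLp 2 (B *ᵥ z) : EuclideanSpace ℝ (Fin 3))) := by
    intro _
    rw [stdLaw_map_mulVec]
    infer_instance
  have h2 := Measure.pi_map_pi (μ := fun _ : Fin n => stdLaw)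
    (f := fun _ z => (WithLp.toLp 2 (B *ᵥ z) : EuclideanSpace ℝ (Fin 3)))
    fun _ => hm.aemeasurable
  rw [← h1, Measure.map_map (by fun_prop) (by fun_prop), stdLaw_map_mulVec] at h2
  exact h2

/-- The middle factor is the empirical second-moment matrix of the noise. -/
lemma sampleCov_linearSample {n : ℕ} (hn : 0 < n) (B : Matrix (Fin 3) (Fin 3) ℝ)
    (ω : ℕ → Fin 3 → ℝ) :
    sampleCov n (linearSample n B ω) = B * (1 + (√n)⁻¹ • fluct n ω) * Bᵀ := by
  have hn' : (0 : ℝ) < n := by exact_mod_cast hn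
  set Z : Matrix (Fin n) (Fin 3) ℝ := Matrix.of fun m j => ω m j with hZ
  have hX : (Matrix.of fun (m : Fin n) j => linearSample n B ω m j) = Z * Bᵀ := by
    ext m j
    simp [linearSample, hZ, Matrix.mul_apply, Matrix.mulVec, dotProduct, mul_comm]
  have hgram : 1 + (√n)⁻¹ • fluct n ω = (n : ℝ)⁻¹ • (Zᵀ * Z) := by
    ext j k
    have hs : (√(n : ℝ))⁻¹ * (√(n : ℝ))⁻¹ = (n : ℝ)⁻¹ := by
      rw [← mul_inv, Real.mul_self_sqrt hn'.le]
    simp only [Matrix.add_apply, Matrix.smul_apply, fluct, Matrix.of_apply, prodDev, smul_eq_mul,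
      hZ, Matrix.mul_apply, Matrix.transpose_apply, Finset.sum_sub_distrib, Finset.sum_const,
      Finset.card_range, nsmul_eq_mul]
    rw [← mul_assoc, hs, Fin.sum_univ_eq_sum_range (fun m => ω m j * ω m k) n]
    field_simp
    ring
  rw [sampleCov_eq, hX, hgram, Matrix.conjTranspose_eq_transpose_of_trivial,
    Matrix.transpose_mul, Matrix.transpose_transpose]
  simp [Matrix.mul_assoc]

end Coupling

/-! ### Correlation matrices, Cholesky factors and scale invariance. -/

section Correlation

open Matrix

/-- The Cholesky factor of the correlation matrix with correlations `r = ρ₁₂`, `s = ρ₁₃`,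
`t = ρ₂₃`. -/
noncomputable def cholesky (r s t : ℝ) : Matrix (Fin 3) (Fin 3) ℝ :=
  !![1, 0, 0; r, √(1 - r ^ 2), 0;
    s, (t - r * s) / √(1 - r ^ 2), √(1 - s ^ 2 - ((t - r * s) / √(1 - r ^ 2)) ^ 2)]

lemma cholesky_mul_transpose {r s t : ℝ} (h1 : 0 < 1 - r ^ 2)
    (h2 : 0 ≤ 1 - s ^ 2 - ((t - r * s) / √(1 - r ^ 2)) ^ 2) :
    cholesky r s t * (cholesky r s t)ᵀ = !![1, r, s; r, 1, t; s, t, 1] := by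
  have e1 := Real.mul_self_sqrt h1.le
  have e2 := Real.mul_self_sqrt h2
  have hne : √(1 - r ^ 2) ≠ 0 := (Real.sqrt_pos.2 h1).ne'
  have e3 : √(1 - r ^ 2) * ((t - r * s) / √(1 - r ^ 2)) = t - r * s := by field_simp
  unfold cholesky
  ext i j
  fin_cases i <;> fin_cases j <;> simp [Matrix.mul_apply, Fin.sum_univ_three] <;> linarith

/-- Vanishing correlations send the factor to the identity and eventually make both radicands
positive, so the factorization is exact from some index on. -/
lemma tendsto_cholesky {ι : Type*} {l : Filter ι} {r s t : ι → ℝ} (hr : Tendsto r l (𝓝 0))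
    (hs : Tendsto s l (𝓝 0)) (ht : Tendsto t l (𝓝 0)) :
    Tendsto (fun n => cholesky (r n) (s n) (t n)) l (𝓝 1) ∧
    ∀ᶠ n in l, cholesky (r n) (s n) (t n) * (cholesky (r n) (s n) (t n))ᵀ =
      !![1, r n, s n; r n, 1, t n; s n, t n, 1] := by
  have h1 : Tendsto (fun n => 1 - r n ^ 2) l (𝓝 1) := by
    simpa using (hr.pow 2).const_sub 1
  have h2 : Tendsto (fun n => √(1 - r n ^ 2)) l (𝓝 1) := by simpa using h1.sqrt
  have h3 : Tendsto (fun n => (t n - r n * s n) / √(1 - r n ^ 2)) l (𝓝 0) := by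
    simpa [Pi.div_def] using (ht.sub (hr.mul hs)).div h2 one_ne_zero
  have h4 : Tendsto (fun n => 1 - s n ^ 2 - ((t n - r n * s n) / √(1 - r n ^ 2)) ^ 2) l
      (𝓝 1) := by
    simpa using ((hs.pow 2).const_sub 1).sub (h3.pow 2)
  have h5 := h4.sqrt
  rw [Real.sqrt_one] at h5
  constructor
  · refine tendsto_pi_nhds.2 fun i => tendsto_pi_nhds.2 fun j => ?_
    unfold cholesky
    fin_cases i <;> fin_cases j <;> simp <;>
      first | assumption | exact tendsto_const_nhds
  · filter_upwards [h1.eventually_const_lt one_pos, h4.eventually_const_lt one_pos] with n a b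
    exact cholesky_mul_transpose a b.le

lemma corr_mul_sqrt {C : Matrix (Fin 3) (Fin 3) ℝ} (hC : C.PosDef) (j k : Fin 3) :
    √(C j j) * corr C j k * √(C k k) = C j k := by
  have hj : 0 < √(C j j) := Real.sqrt_pos.2 hC.diag_pos
  have hk : 0 < √(C k k) := Real.sqrt_pos.2 hC.diag_pos
  rw [corr, Real.sqrt_mul hC.diag_pos.le]
  field_simp

lemma corr_self {C : Matrix (Fin 3) (Fin 3) ℝ} (hC : C.PosDef) (j : Fin 3) : corr C j j = 1 := by
  have hj : 0 < C j j := hC.diag_pos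
  rw [corr, Real.sqrt_mul_self hj.le, div_self hj.ne']

lemma corr_comm {C : Matrix (Fin 3) (Fin 3) ℝ} (hC : C.PosDef) (j k : Fin 3) :
    corr C j k = corr C k j := by
  rw [corr, corr, posDef_apply_comm hC, mul_comm]

lemma diagonal_mul_corr_mul_diagonal {C : Matrix (Fin 3) (Fin 3) ℝ} (hC : C.PosDef) :
    diagonal (fun j => √(C j j)) * !![1, corr C 0 1, corr C 0 2; corr C 0 1, 1, corr C 1 2;
      corr C 0 2, corr C 1 2, 1] * diagonal (fun j => √(C j j)) = C := by
  have hR : !![1, corr C 0 1, corr C 0 2; corr C 0 1, 1, corr C 1 2;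
      corr C 0 2, corr C 1 2, 1] = Matrix.of fun j k => corr C j k := by
    ext j k
    fin_cases j <;> fin_cases k <;>
      simp [corr_self hC, corr_comm hC 1 0, corr_comm hC 2 0, corr_comm hC 2 1]
  ext j k
  rw [hR, Matrix.mul_diagonal, Matrix.diagonal_mul, Matrix.of_apply, corr_mul_sqrt hC]

lemma posDef_diagonal_mul_mul_diagonal {S : Matrix (Fin 3) (Fin 3) ℝ} (hS : S.PosDef)
    {d : Fin 3 → ℝ} (hd : ∀ j, 0 < d j) : (diagonal d * S * diagonal d).PosDef := by
  have h := hS.mul_mul_conjTranspose_same (B := diagonal d) (by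
    intro v w hvw
    funext j
    have := congrFun hvw j
    simp only [Matrix.vecMul_diagonal] at this
    exact mul_right_cancel₀ (hd j).ne' this)
  simpa using h

lemma minorRatio_diagonal_mul_mul_diagonal (S : Matrix (Fin 3) (Fin 3) ℝ)
    {d : Fin 3 → ℝ} (hd : ∀ j, 0 < d j) :
    minorRatio (diagonal d * S * diagonal d) = minorRatio S := by
  have h0 := hd 0
  have h1 := hd 1
  have h2 := hd 2
  simp only [minorRatio, Matrix.det_mul, Matrix.det_diagonal, Fin.prod_univ_three,
    Matrix.mul_diagonal, Matrix.diagonal_mul]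
  -- Each coordinate lies in two of the three minors; numerator and denominator both scale by this
  -- factor.
  have hne : d 0 ^ 4 * d 1 ^ 4 * d 2 ^ 4 ≠ 0 := by positivity
  rw [← mul_div_mul_left _ (S 0 0 * S 1 1 * S 2 2 * S.det) hne]
  congr 1 <;> ring

end Correlation

/-! ### Convergence in probability and in law. -/

section Limit

open Matrix

lemma lrStat_linearSample_diagonal_mul {n : ℕ} (hn : 0 < n) {d : Fin 3 → ℝ} (hd : ∀ j, 0 < d j)
    (A : Matrix (Fin 3) (Fin 3) ℝ) (ω : ℕ → Fin 3 → ℝ)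
    (hpd : (A * (1 + (√n)⁻¹ • fluct n ω) * Aᵀ).PosDef) :
    lrStat n (linearSample n (diagonal d * A) ω) =
      n * Real.log (minorRatio (A * (1 + (√n)⁻¹ • fluct n ω) * Aᵀ)) := by
  have h : sampleCov n (linearSample n (diagonal d * A) ω) =
      diagonal d * (A * (1 + (√n)⁻¹ • fluct n ω) * Aᵀ) * diagonal d := by
    rw [sampleCov_linearSample hn, Matrix.transpose_mul, Matrix.diagonal_transpose]
    simp only [Matrix.mul_assoc]
  rw [lrStat_eq, h, minorRatio_diagonal_mul_mul_diagonal _ hd]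
  rw [h]
  exact posDef_diagonal_mul_mul_diagonal hpd hd

/-- The likelihood ratio statistic is asymptotically a linear function of the fluctuation of the
covariance of the first two coordinates. -/
lemma tendstoInMeasure_lrStat_sub {A : ℕ → Matrix (Fin 3) (Fin 3) ℝ}
    (hA : Tendsto A atTop (𝓝 1)) {c δ : ℝ}
    (h01 : Tendsto (fun n : ℕ => √n * (A n * (A n)ᵀ) 0 1) atTop (𝓝 c))
    (hprod : Tendsto (fun n : ℕ => √n * ((A n * (A n)ᵀ) 0 2 * (A n * (A n)ᵀ) 1 2)) atTop (𝓝 δ))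
    {d : ℕ → Fin 3 → ℝ} (hd : ∀ᶠ n in atTop, ∀ j, 0 < d n j) :
    TendstoInMeasure noiseLaw
      ((fun n ω => lrStat n (linearSample n (diagonal (d n) * A n) ω)) -
        fun n ω => δ ^ 2 - 2 * δ * (c + fluct n ω 0 1)) atTop 0 := by
  rw [tendstoInMeasure_iff_norm]
  intro ε hε
  rw [ENNReal.tendsto_nhds_zero]
  intro η hη
  obtain ⟨M, hM⟩ := exists_noiseLaw_fluct_le hη
  -- A limit along `atTop` times the principal filter of all of `T` is a limit uniform over
  -- symmetric matrices bounded by `M`. The bad event thus forces some entry of the fluctuation to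
  -- reach `M`.
  set T := {g : Matrix (Fin 3) (Fin 3) ℝ // g.IsSymm ∧ ∀ j k, |g j k| ≤ M}
  obtain ⟨hpd, hlim⟩ := tendsto_mul_log_minorRatio_perturbation
    (l := (atTop : Filter ℕ) ×ˢ (𝓟 Set.univ : Filter T)) (N := Prod.fst) tendsto_fst hA h01 hprod
    (G := fun x => x.2.1) (fun x => x.2.2.1) (fun j k => by
      refine IsBigO.of_bound M (Eventually.of_forall fun x => ?_)
      simpa using x.2.2.2 j k)
  have hsmall := (Metric.tendsto_nhds.1 hlim) ε hε
  rw [eventually_prod_principal_iff] at hpd hsmall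
  filter_upwards [hpd, hsmall, hd, eventually_gt_atTop 0] with n hpd hsmall hd hn
  refine (measure_mono ?_).trans (hM n hn)
  intro ω hω
  simp only [Set.mem_ofPred_eq, Pi.sub_apply, Pi.zero_apply, sub_zero] at hω ⊢
  by_contra! hcon
  have hp := hpd ⟨fluct n ω, fluct_isSymm n ω, fun j k => (hcon j k).le⟩ (Set.mem_univ _)
  have hs := hsmall ⟨fluct n ω, fluct_isSymm n ω, fun j k => (hcon j k).le⟩ (Set.mem_univ _)
  rw [lrStat_linearSample_diagonal_mul hn hd _ ω hp] at hω
  rw [Real.dist_eq, sub_zero] at hs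
  exact absurd hω (not_le.2 hs)

lemma tendstoInDistribution_lrStat_linearSample {A : ℕ → Matrix (Fin 3) (Fin 3) ℝ}
    (hA : Tendsto A atTop (𝓝 1)) {c δ : ℝ}
    (h01 : Tendsto (fun n : ℕ => √n * (A n * (A n)ᵀ) 0 1) atTop (𝓝 c))
    (hprod : Tendsto (fun n : ℕ => √n * ((A n * (A n)ᵀ) 0 2 * (A n * (A n)ᵀ) 1 2)) atTop (𝓝 δ))
    {d : ℕ → Fin 3 → ℝ} (hd : ∀ᶠ n in atTop, ∀ j, 0 < d n j) :
    TendstoInDistribution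
      (fun n ω => lrStat n (linearSample n (diagonal (d n) * A n) ω)) atTop
      (fun z : ℝ => δ ^ 2 - 2 * δ * (c + -z)) (fun _ => noiseLaw) (gaussianReal 0 1) := by
  -- By symmetry the normal limit may be taken as `-z`, which turns `-2δ` into the required
  -- coefficient `+2δ`.
  have hY : HasLaw (fun z : ℝ => -z) (gaussianReal 0 1) (gaussianReal 0 1) :=
    ⟨by fun_prop, by rw [gaussianReal_map_neg, neg_zero]⟩
  have h1 := (tendstoInDistribution_fluct hY).continuous_comp
    (g := fun x => δ ^ 2 - 2 * δ * (c + x)) (by fun_prop)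
  exact tendstoInDistribution_of_tendstoInMeasure_sub _ _ h1
    (tendstoInMeasure_lrStat_sub hA h01 hprod hd)
    fun n => ((measurable_lrStat n).comp (measurable_linearSample n _)).aemeasurable

lemma gaussianReal_map_limit (δ e : ℝ) :
    (gaussianReal 0 1).map (fun z : ℝ => δ * (2 * z + e * δ)) =
      gaussianReal (e * δ ^ 2) ((2 * δ) ^ 2).toNNReal := by
  have h : (fun z : ℝ => δ * (2 * z + e * δ)) =
      (fun z => z + e * δ ^ 2) ∘ fun z => (2 * δ) * z := by
    funext z
    simp only [Function.comp_apply]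
    ring
  rw [h, ← Measure.map_map (by fun_prop) (by fun_prop), gaussianReal_map_const_mul,
    gaussianReal_map_add_const]
  congr 1
  · ring
  · ext
    simp [Real.coe_toNNReal _ (sq_nonneg (2 * δ))]

end Limit

end TrivariateGaussian

open TrivariateGaussian in
theorem mainTheorem3 (i : Fin 2) (δ : ℝ) (hδ : δ ≠ 0)
    (C : ℕ → Matrix (Fin 3) (Fin 3) ℝ)
    (hC : ∀ n, 1 ≤ n → C n ∈ TrivariateGaussian.model i \ TrivariateGaussian.model (1 - i))
    (h13 : Tendsto (fun n => TrivariateGaussian.corr (C n) 0 2) atTop (𝓝 0))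
    (h23 : Tendsto (fun n => TrivariateGaussian.corr (C n) 1 2) atTop (𝓝 0))
    (hprod : (fun n : ℕ => TrivariateGaussian.corr (C n) 0 2 * TrivariateGaussian.corr (C n) 1 2
        - δ * (n : ℝ) ^ (-(1 / 2) : ℝ)) =o[atTop] fun n : ℕ => (n : ℝ) ^ (-(1 / 2) : ℝ)) :
    -- the suprema defining the statistic are almost surely finite
    (∀ n, 3 ≤ n → ∀ᵐ x ∂TrivariateGaussian.sampleLaw n (C n), ∀ j : Fin 2,
      BddAbove (TrivariateGaussian.logLik n (TrivariateGaussian.sampleCov n x) ''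
        TrivariateGaussian.model j)) ∧
    -- convergence in law to `δ (2 Z + (-1)ⁱ δ)` with `Z` standard normal
    TendstoInDistribution (fun n => TrivariateGaussian.lrStat n) atTop
      (fun z : ℝ => δ * (2 * z + (-1) ^ (i : ℕ) * δ))
      (fun n => TrivariateGaussian.sampleLaw n (C n)) (gaussianReal 0 1) ∧
    -- the law of the limit
    (gaussianReal 0 1).map (fun z : ℝ => δ * (2 * z + (-1) ^ (i : ℕ) * δ)) =
      gaussianReal ((-1) ^ (i : ℕ) * δ ^ 2) ((2 * δ) ^ 2).toNNReal := by
  have hpos : ∀ n, 1 ≤ n → (C n).PosDef := fun n hn => model_subset_posDef i (hC n hn).1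
  refine ⟨fun n hn => ?_, ?_, gaussianReal_map_limit δ _⟩
  · filter_upwards [ae_posDef_sampleCov hn (hpos n (by omega))] with x hx j
    exact bddAbove_logLik n hx j
  have hrate : Tendsto (fun n : ℕ => √n * (corr (C n) 0 2 * corr (C n) 1 2)) atTop (𝓝 δ) := by
    have h := hprod.tendsto_div_nhds_zero.add_const δ
    rw [zero_add] at h
    refine h.congr' ?_
    filter_upwards [eventually_gt_atTop 0] with n hn
    have hn' : (0 : ℝ) < n := by exact_mod_cast hn
    rw [Real.rpow_neg hn'.le, ← Real.sqrt_eq_rpow]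
    have : 0 < √(n : ℝ) := Real.sqrt_pos.2 hn'
    field_simp
    ring
  -- Only here does the true model matter: `c = 0` for `i = 0`, and `c = δ` for `i = 1`.
  obtain ⟨c, hc, h12, h12'⟩ : ∃ c : ℝ, δ ^ 2 - 2 * δ * c = (-1) ^ (i : ℕ) * δ ^ 2 ∧
      Tendsto (fun n => corr (C n) 0 1) atTop (𝓝 0) ∧
      Tendsto (fun n : ℕ => √n * corr (C n) 0 1) atTop (𝓝 c) := by
    have hi : i = 0 ∨ i = 1 := by fin_cases i <;> simp
    rcases hi with rfl | rfl
    · have h0 : ∀ᶠ n in atTop, 0 = corr (C n) 0 1 := by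
        filter_upwards [eventually_ge_atTop 1] with n hn
        have h := (hC n hn).1.2
        simp [corr, h]
      refine ⟨0, by simp, tendsto_const_nhds.congr' h0, tendsto_const_nhds.congr' ?_⟩
      filter_upwards [h0] with n hn
      rw [← hn, mul_zero]
    · have h0 : ∀ᶠ n in atTop, corr (C n) 0 2 * corr (C n) 1 2 = corr (C n) 0 1 := by
        filter_upwards [eventually_ge_atTop 1] with n hn
        have h : C n 0 1 * C n 2 2 = C n 0 2 * C n 1 2 := (hC n hn).1.2
        have hp := hpos n hn
        have d0 : 0 < √(C n 0 0) := Real.sqrt_pos.2 hp.diag_pos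
        have d1 : 0 < √(C n 1 1) := Real.sqrt_pos.2 hp.diag_pos
        have d2 : 0 < √(C n 2 2) := Real.sqrt_pos.2 hp.diag_pos
        have e2 : √(C n 2 2) * √(C n 2 2) = C n 2 2 := Real.mul_self_sqrt hp.diag_pos.le
        rw [← corr_mul_sqrt hp 0 1, ← corr_mul_sqrt hp 0 2, ← corr_mul_sqrt hp 1 2] at h
        have hne : √(C n 0 0) * √(C n 1 1) * (√(C n 2 2) * √(C n 2 2)) ≠ 0 := by positivity
        refine mul_left_cancel₀ hne ?_
        linear_combination -h - √(C n 0 0) * √(C n 1 1) * corr (C n) 0 1 * e2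
      refine ⟨δ, by simp; ring, ?_, hrate.congr' ?_⟩
      · have := h13.mul h23
        rw [mul_zero] at this
        exact this.congr' h0
      · filter_upwards [h0] with n hn
        rw [hn]
  obtain ⟨hA, hAA⟩ := tendsto_cholesky h12 h13 h23
  set A := fun n => cholesky (corr (C n) 0 1) (corr (C n) 0 2) (corr (C n) 1 2)
  have hlim := tendstoInDistribution_lrStat_linearSample hA (c := c) (δ := δ)
    (h12'.congr' (by filter_upwards [hAA] with n hn; rw [hn]; simp))
    (hrate.congr' (by filter_upwards [hAA] with n hn; rw [hn]; simp))
    (d := fun n j => √(C n j j)) (by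
      filter_upwards [eventually_ge_atTop 1] with n hn j
      exact Real.sqrt_pos.2 (hpos n hn).diag_pos)
  have hfun : (fun z : ℝ => δ ^ 2 - 2 * δ * (c + -z)) =
      fun z => δ * (2 * z + (-1) ^ (i : ℕ) * δ) := by
    funext z
    linear_combination hc
  rw [hfun] at hlim
  -- Convergence in law involves only the laws, which agree with those of the coupled statistic for
  -- large `n`. Measurability is needed at every `n`, including `n = 0`, where `C 0` is
  -- unconstrained.
  refine ⟨fun n => (measurable_lrStat n).aemeasurable, hlim.aemeasurable_limit, ?_⟩
  refine hlim.tendsto.congr' ?_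
  filter_upwards [hAA, eventually_ge_atTop 1] with n hn hn1
  apply Subtype.ext
  change noiseLaw.map (lrStat n ∘ linearSample n _) = (sampleLaw n (C n)).map (lrStat n)
  rw [← Measure.map_map (measurable_lrStat n) (measurable_linearSample n _),
    noiseLaw_map_linearSample]
  congr 2
  rw [Matrix.transpose_mul, Matrix.diagonal_transpose]
  refine Eq.trans ?_ (diagonal_mul_corr_mul_diagonal (hpos n hn1))
  rw [← hn]
  simp only [A, Matrix.mul_assoc]
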